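/- Let $(S_n)_{n\ge 0}$ be the simple random walk on the nearest-neighbour graph $\mathbb{Z}^2$ started at the origin, with law $P^0$ and expectation $E^{P^0}$. Let $R_n = |\{S_0,\dots,S_n\}|$, and let $L_n$ be the number of vertices $x\in\{S_0,\dots,S_n\}$ that have at least one neighbour in $\mathbb{Z}^2$ outside $\{S_0,\dots,S_n\}$. Then $$\limsup_{n\to\infty}\frac{(\log n)^4}{n^2}\,E^{P^0}\left[L_n^2\right]<+\infty ,$$ that is, $E^{P^0}[L_n^2]=O\left(n^2/(\log n)^4\right)$ as $n\to\infty$, and $$\lim_{n\to\infty}\frac{L_n}{R_n}=0\qquad P^0\text{-almost surely.}$$ -/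

import Mathlib

open MeasureTheory Filter Topology
open scoped ENNReal

noncomputable section

namespace TraceBoundary

/-- The nearest-neighbour graph on `ℤ²`: two vertices are adjacent iff their `ℓ¹`-distance is 1. -/
def latticeGraph : SimpleGraph (ℤ × ℤ) where
  Adj x y := |x.1 - y.1| + |x.2 - y.2| = 1
  symm := ⟨fun x y h => by rwa [abs_sub_comm y.1 x.1, abs_sub_comm y.2 x.2]⟩
  loopless := ⟨fun x h => by simp at h⟩

/-- The four unit steps of `ℤ²`. -/
def unitSteps : Finset (ℤ × ℤ) := {(1, 0), (-1, 0), (0, 1), (0, -1)}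

/-- The four unit steps are exactly the neighbours of the origin (translated to any vertex). -/
theorem adj_iff_sub_mem_unitSteps (x y : ℤ × ℤ) :
    latticeGraph.Adj x y ↔ y - x ∈ unitSteps := by
  obtain ⟨a, b⟩ := x
  obtain ⟨c, d⟩ := y
  simp only [latticeGraph, unitSteps, Finset.mem_insert, Finset.mem_singleton, Prod.mk_sub_mk,
    Prod.mk.injEq]
  rcases abs_cases (a - c) with h | h <;> rcases abs_cases (b - d) with h' | h' <;> omega

theorem unitSteps_nonempty : unitSteps.Nonempty := ⟨(1, 0), by simp [unitSteps]⟩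

/-- The law of one step: uniform on the four unit steps. -/
def stepLaw : Measure (ℤ × ℤ) :=
  (PMF.uniformOfFinset unitSteps unitSteps_nonempty).toMeasure

instance : IsProbabilityMeasure stepLaw := by
  unfold stepLaw; infer_instance

/-- The path started at `x` with successive steps `ξ 0, ξ 1, …`:
its position at time `n` is `x + ξ 0 + ⋯ + ξ (n - 1)`. -/
def pathOfSteps (x : ℤ × ℤ) (ξ : ℕ → ℤ × ℤ) (n : ℕ) : ℤ × ℤ :=
  x + ∑ i ∈ Finset.range n, ξ i

theorem measurable_pathOfSteps (x : ℤ × ℤ) : Measurable (pathOfSteps x) := by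
  refine measurable_pi_lambda _ fun n => ?_
  unfold pathOfSteps
  fun_prop

/-- The law `P^x`, on the space of paths `ℕ → ℤ²`, of simple random walk on `ℤ²` started at `x`:
the law of the partial sums of independent steps, each with law `stepLaw`. -/
def srwLaw (x : ℤ × ℤ) : Measure (ℕ → ℤ × ℤ) :=
  (Measure.infinitePi fun _ : ℕ => stepLaw).map (pathOfSteps x)

instance (x : ℤ × ℤ) : IsProbabilityMeasure (srwLaw x) :=
  Measure.isProbabilityMeasure_map (measurable_pathOfSteps x).aemeasurable

open scoped Classical in
/-- The trace `S[0, n] = {S 0, …, S n}` of a path. -/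
def trace {V : Type*} (S : ℕ → V) (n : ℕ) : Finset V :=
  (Finset.range (n + 1)).image S

/-- The range `R_n`: the number of distinct vertices visited up to time `n`. -/
def rangeSize {V : Type*} (S : ℕ → V) (n : ℕ) : ℕ :=
  (trace S n).card

open scoped Classical in
/-- The inner boundary of the trace: the vertices of the trace
that have a neighbour outside the trace. -/
def innerBoundary {V : Type*} (G : SimpleGraph V) (S : ℕ → V) (n : ℕ) : Finset V :=
  (trace S n).filter fun x => ¬ G.neighborSet x ⊆ (trace S n : Set V)

/-- The size `L_n` of the inner boundary of the trace. -/
def boundarySize {V : Type*} (G : SimpleGraph V) (S : ℕ → V) (n : ℕ) : ℕ :=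
  (innerBoundary G S n).card

end TraceBoundary

end

noncomputable section

namespace TraceBoundary

open ProbabilityTheory

/-! A boundary vertex visited at time `k ≤ n` has a neighbour, in some direction `e`, that is missed
by the whole path up to time `n`; hence `L_n` is at most the number of pairs `(e, k)` for which
`missed e n k` occurs (`boundarySize_le`). Seen from time `k`, both the future walk and the
time-reversed past must then avoid a given unit vector. Planar recurrence makes avoidance for `m`
steps have probability `O(1 / log m)` (`log_mul_avoid_le`): decompose at the last visit to the
origin, and use that the expected number of returns is at least of order `log m`.

Second moment: for two times `k < l` that are well separated from each other and from `0` and `n`,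
the events at `k` and `l` force four avoidances on disjoint blocks of steps, so their joint
probability is `O(1 / (log n)^4)`. With separation scale `√n`, the remaining pairs number only
`O(n^{3/2})`.

Almost sure ratio: a Borel–Cantelli argument from moments is avoided. Fix `e` and call `k` a trial
if the neighbour in direction `e` is still unvisited at time `k`; this is decided by the past. An
exponential supermartingale (`ae_exists_sum_success_le`) shows that if the next `T` steps must lie
in a set of probability `p`, the number of trials where this happens is at most `c(p)` times the
number of trials, up to a random constant, with `c(p) ≤ 2p` and `c(p) < 1` for `p < 1`. It is used
three times: steps other than `e` (`p = 3/4`) show that a positive fraction of trials discover a new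
vertex, so trials are `O(R_n)`; avoidance for `T` steps (`p = O(1 / log T)`) shows that missed
neighbours are `O(1 / log T)` times the trials; failure to run straight shows that `R_n → ∞`. Then
let `n → ∞` and afterwards `T → ∞`. -/

/-- The law of the sequence of steps of the walk. -/
def stepsLaw : Measure (ℕ → ℤ × ℤ) := Measure.infinitePi fun _ : ℕ => stepLaw

instance : IsProbabilityMeasure stepsLaw := by
  unfold stepsLaw; infer_instance

/-! ### Events depending on finitely many steps: measurability, independence, shift and reversal -/

theorem exists_eq_comp_restrict {β : Type*} {f : (ℕ → ℤ × ℤ) → β} {S : Finset ℕ}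
    (hf : DependsOn f (S : Set ℕ)) : ∃ g : (S → ℤ × ℤ) → β, f = g ∘ S.restrict := by
  classical
  refine ⟨fun y => f fun i => if h : i ∈ S then y ⟨i, h⟩ else 0, ?_⟩
  funext x
  refine hf fun i hi => ?_
  have hi' : i ∈ S := hi
  simp [hi']

/-- Finitely many coordinates in a countable discrete space take countably many values, so
measurability is automatic. Throughout, `DependsOn` replaces measurability proofs and records which
blocks of steps are used. -/
theorem measurable_of_dependsOn {β : Type*} [MeasurableSpace β] {f : (ℕ → ℤ × ℤ) → β}
    {S : Finset ℕ} (hf : DependsOn f (S : Set ℕ)) : Measurable f := by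
  obtain ⟨g, rfl⟩ := exists_eq_comp_restrict hf
  exact (measurable_of_countable g).comp (Finset.measurable_restrict S)

theorem measurableSet_of_dependsOn {A : Set (ℕ → ℤ × ℤ)} {S : Finset ℕ}
    (hA : DependsOn (· ∈ A) (S : Set ℕ)) : MeasurableSet A :=
  measurableSet_setOfPred.2 (measurable_of_dependsOn hA)

theorem iIndepFun_eval_stepsLaw : iIndepFun (fun i (ξ : ℕ → ℤ × ℤ) => ξ i) stepsLaw :=
  iIndepFun_infinitePi (P := fun _ : ℕ => stepLaw) (X := fun _ x => x) fun _ => measurable_id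

theorem indepFun_of_dependsOn {β γ : Type*} [MeasurableSpace β] [MeasurableSpace γ]
    {f : (ℕ → ℤ × ℤ) → β} {g : (ℕ → ℤ × ℤ) → γ} {S T : Finset ℕ} (hST : Disjoint S T)
    (hf : DependsOn f (S : Set ℕ)) (hg : DependsOn g (T : Set ℕ)) :
    IndepFun f g stepsLaw := by
  obtain ⟨f, rfl⟩ := exists_eq_comp_restrict hf
  obtain ⟨g, rfl⟩ := exists_eq_comp_restrict hg
  exact (iIndepFun_eval_stepsLaw.indepFun_finset S T hST fun i => measurable_pi_apply i).comp
    (measurable_of_countable f) (measurable_of_countable g)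

theorem stepsLaw_real_inter {A B : Set (ℕ → ℤ × ℤ)} {S T : Finset ℕ} (hST : Disjoint S T)
    (hA : DependsOn (· ∈ A) (S : Set ℕ)) (hB : DependsOn (· ∈ B) (T : Set ℕ)) :
    stepsLaw.real (A ∩ B) = stepsLaw.real A * stepsLaw.real B := by
  have h := (indepFun_of_dependsOn hST hA hB).measure_inter_preimage_eq_mul {True} {True}
    trivial trivial
  have hA' : (fun ξ => ξ ∈ A) ⁻¹' {True} = A := by ext; simp
  have hB' : (fun ξ => ξ ∈ B) ⁻¹' {True} = B := by ext; simp
  rw [hA', hB'] at h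
  simp [Measure.real, h]

theorem dependsOn_inter {A B : Set (ℕ → ℤ × ℤ)} {S T : Finset ℕ}
    (hA : DependsOn (· ∈ A) (S : Set ℕ)) (hB : DependsOn (· ∈ B) (T : Set ℕ)) :
    DependsOn (· ∈ A ∩ B) ((S ∪ T : Finset ℕ) : Set ℕ) := by
  intro x y hxy
  have h1 := hA fun i hi => hxy i (by simp at hi ⊢; exact Or.inl hi)
  have h2 := hB fun i hi => hxy i (by simp at hi ⊢; exact Or.inr hi)
  simp only [Set.mem_inter_iff] at *
  rw [h1, h2]

/-- Distinct coordinates of an i.i.d. sequence are again i.i.d. with the same law; this covers both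
shifting and reversing. -/
theorem measurePreserving_reindex {σ : ℕ → ℕ} (hσ : Function.Injective σ) :
    MeasurePreserving (fun (ξ : ℕ → ℤ × ℤ) i => ξ (σ i)) stepsLaw stepsLaw := by
  have hm : Measurable fun (ξ : ℕ → ℤ × ℤ) i => ξ (σ i) := by fun_prop
  refine ⟨hm, ?_⟩
  have h := (iIndepFun_eval_stepsLaw.precomp hσ).map_fun_eq_infinitePi_map
    (fun i => measurable_pi_apply (σ i))
  have h' : ∀ i, stepsLaw.map (fun ξ : ℕ → ℤ × ℤ => ξ (σ i)) = stepLaw := fun i =>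
    Measure.infinitePi_map_eval (fun _ : ℕ => stepLaw) (σ i)
  refine h.trans ?_
  simp only [h']
  rfl

/-- The steps from time `a` on. -/
def shift (a : ℕ) (ξ : ℕ → ℤ × ℤ) (i : ℕ) : ℤ × ℤ := ξ (a + i)

/-- The steps before time `b` in reversed order (followed by the steps from time `b` on). -/
def reverse (b : ℕ) (ξ : ℕ → ℤ × ℤ) (i : ℕ) : ℤ × ℤ := ξ (if i < b then b - 1 - i else i)

theorem measurePreserving_shift (a : ℕ) : MeasurePreserving (shift a) stepsLaw stepsLaw :=
  measurePreserving_reindex (add_right_injective a)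

theorem measurePreserving_reverse (b : ℕ) : MeasurePreserving (reverse b) stepsLaw stepsLaw := by
  refine measurePreserving_reindex fun i j h => ?_
  split_ifs at h <;> omega

theorem dependsOn_shift {β : Type*} {f : (ℕ → ℤ × ℤ) → β} {m : ℕ}
    (hf : DependsOn f (Finset.range m : Set ℕ)) (a : ℕ) :
    DependsOn (fun ξ => f (shift a ξ)) (Finset.Ico a (a + m) : Set ℕ) := by
  intro x y hxy
  refine hf fun i hi => hxy _ ?_
  simp at hi ⊢
  omega

theorem dependsOn_reverse {β : Type*} {f : (ℕ → ℤ × ℤ) → β} {m b : ℕ} (hmb : m ≤ b)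
    (hf : DependsOn f (Finset.range m : Set ℕ)) :
    DependsOn (fun ξ => f (reverse b ξ)) (Finset.Ico (b - m) b : Set ℕ) := by
  intro x y hxy
  refine hf fun i hi => hxy _ ?_
  simp at hi ⊢
  split_ifs <;> omega

theorem stepsLaw_real_shift {A : Set (ℕ → ℤ × ℤ)} {m : ℕ}
    (hA : DependsOn (· ∈ A) (Finset.range m : Set ℕ)) (a : ℕ) :
    stepsLaw.real (shift a ⁻¹' A) = stepsLaw.real A := by
  simp [Measure.real,
    (measurePreserving_shift a).measure_preimage (measurableSet_of_dependsOn hA).nullMeasurableSet]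

theorem stepsLaw_real_reverse {A : Set (ℕ → ℤ × ℤ)} {m : ℕ}
    (hA : DependsOn (· ∈ A) (Finset.range m : Set ℕ)) (b : ℕ) :
    stepsLaw.real (reverse b ⁻¹' A) = stepsLaw.real A := by
  simp [Measure.real,
    (measurePreserving_reverse b).measure_preimage
      (measurableSet_of_dependsOn hA).nullMeasurableSet]

theorem stepsLaw_real_step_eq (i : ℕ) {e : ℤ × ℤ} (he : e ∈ unitSteps) :
    stepsLaw.real {ξ | ξ i = e} = 1 / 4 := by
  have h : stepsLaw {ξ | ξ i = e} = stepLaw {e} := by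
    have h' := (measurePreserving_eval_infinitePi (fun _ : ℕ => stepLaw) i).measure_preimage
      (MeasurableSet.singleton e).nullMeasurableSet
    exact h'
  have hc : unitSteps.card = 4 := by decide
  rw [Measure.real, h, stepLaw, PMF.toMeasure_apply_singleton _ _ (MeasurableSet.singleton e),
    PMF.uniformOfFinset_apply_of_mem _ he, hc]
  simp

/-! ### Avoidance probabilities and the logarithmic growth of the Green sum -/

/-- The position at time `j` of the walk started at the origin. -/
def walk (j : ℕ) (ξ : ℕ → ℤ × ℤ) : ℤ × ℤ := ∑ i ∈ Finset.range j, ξ i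

theorem dependsOn_walk (j : ℕ) : DependsOn (walk j) (Finset.range j : Set ℕ) := fun _ _ h =>
  Finset.sum_congr rfl fun i hi => h i hi

theorem walk_add (a j : ℕ) (ξ : ℕ → ℤ × ℤ) : walk (a + j) ξ = walk a ξ + walk j (shift a ξ) :=
  Finset.sum_range_add ξ a j

/-- Going back in time from `b` subtracts the steps in reversed order, so the past seen from time
`b` is the negative of a walk with the same law. -/
theorem walk_sub {j b : ℕ} (h : j ≤ b) (ξ : ℕ → ℤ × ℤ) :
    walk (b - j) ξ = walk b ξ - walk j (reverse b ξ) := by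
  rw [eq_sub_iff_add_eq]
  induction j with
  | zero => simp [walk]
  | succ j ih =>
    rw [← ih (by omega), show b - j = b - (j + 1) + 1 by omega]
    simp only [walk, Finset.sum_range_succ]
    have : reverse b ξ j = ξ (b - (j + 1)) := by
      simp only [reverse, if_pos (show j < b by omega)]
      congr 1; omega
    rw [this]; abel

/-- The event that the walk does not visit `e` up to time `m`. -/
def avoid (e : ℤ × ℤ) (m : ℕ) : Set (ℕ → ℤ × ℤ) := {ξ | ∀ j ≤ m, walk j ξ ≠ e}

theorem dependsOn_avoid (e : ℤ × ℤ) (m : ℕ) :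
    DependsOn (· ∈ avoid e m) (Finset.range m : Set ℕ) := by
  intro x y h
  have h' : ∀ j ≤ m, walk j x = walk j y := fun j hj =>
    dependsOn_walk j fun i hi => h i (by simp at hi ⊢; omega)
  simp only [avoid, Set.mem_ofPred_eq, eq_iff_iff]
  exact forall₂_congr fun j hj => by rw [h' j hj]

theorem avoid_antitone (e : ℤ × ℤ) : Antitone (avoid e) := fun _ _ h _ hξ j hj =>
  hξ j (hj.trans h)

/-- The expected number of visits of the walk to the origin up to time `m`. -/
def greenSum (m : ℕ) : ℝ := ∑ k ∈ Finset.range (m + 1), stepsLaw.real {ξ | walk k ξ = 0}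

theorem dependsOn_walk_eq (k : ℕ) (x : ℤ × ℤ) :
    DependsOn (· ∈ {ξ | walk k ξ = x}) (Finset.range k : Set ℕ) := fun _ _ h => by
  simp only [Set.mem_ofPred_eq, dependsOn_walk k h]

theorem dependsOn_step_eq (k : ℕ) (x : ℤ × ℤ) :
    DependsOn (· ∈ {ξ : ℕ → ℤ × ℤ | ξ k = x}) (({k} : Finset ℕ) : Set ℕ) := fun _ _ h => by
  simp only [Set.mem_ofPred_eq, h k (by simp)]

theorem neg_mem_unitSteps {e : ℤ × ℤ} (he : e ∈ unitSteps) : -e ∈ unitSteps := by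
  revert e; decide

/-- Last-visit decomposition: be at the origin at time `k`, step to `-e`, then make no displacement
`e`, that is, do not return, for `m` steps. These events are disjoint for `k ≤ m`, and the step
costs a factor `1 / 4`. -/
theorem greenSum_mul_avoid_le {e : ℤ × ℤ} (he : e ∈ unitSteps) (m : ℕ) :
    greenSum m * stepsLaw.real (avoid e m) ≤ 4 := by
  let F : ℕ → Set (ℕ → ℤ × ℤ) := fun k =>
    {ξ | walk k ξ = 0} ∩ ({ξ | ξ k = -e} ∩ shift (k + 1) ⁻¹' avoid e m)
  have hsd : ∀ k, DependsOn (· ∈ shift (k + 1) ⁻¹' avoid e m)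
      (Finset.Ico (k + 1) (k + 1 + m) : Set ℕ) := fun k =>
    dependsOn_shift (dependsOn_avoid e m) (k + 1)
  have hd2 : ∀ k, DependsOn (· ∈ {ξ | ξ k = -e} ∩ shift (k + 1) ⁻¹' avoid e m)
      (({k} ∪ Finset.Ico (k + 1) (k + 1 + m) : Finset ℕ) : Set ℕ) := fun k =>
    dependsOn_inter (dependsOn_step_eq k (-e)) (hsd k)
  have hd3 : ∀ k, DependsOn (· ∈ F k)
      ((Finset.range k ∪ ({k} ∪ Finset.Ico (k + 1) (k + 1 + m)) : Finset ℕ) : Set ℕ) := fun k =>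
    dependsOn_inter (dependsOn_walk_eq k 0) (hd2 k)
  have hF : ∀ k, stepsLaw.real (F k) =
      stepsLaw.real {ξ | walk k ξ = 0} * (1 / 4 * stepsLaw.real (avoid e m)) := fun k => by
    rw [stepsLaw_real_inter ?_ (dependsOn_walk_eq k 0) (hd2 k),
      stepsLaw_real_inter ?_ (dependsOn_step_eq k (-e)) (hsd k),
      stepsLaw_real_step_eq k (neg_mem_unitSteps he), stepsLaw_real_shift (dependsOn_avoid e m)]
    · rw [Finset.disjoint_left]; intro i hi; simp at hi ⊢; omega
    · rw [Finset.disjoint_left]; intro i hi; simp at hi ⊢; omega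
  -- A visit to the origin at `k'` would be a displacement `e` from `-e` at time `k' - (k + 1) ≤ m`,
  -- which the event for `k` forbids.
  have hdisj : ∀ k k', k < k' → k' ≤ m → Disjoint (F k) (F k') := by
    intro k k' hk hk'
    rw [Set.disjoint_left]
    rintro ξ ⟨h0, h1, h2⟩ ⟨h0', -⟩
    refine h2 (k' - (k + 1)) (by omega) ?_
    simp only [Set.mem_ofPred_eq] at h0 h1 h0'
    have := walk_add (k + 1) (k' - (k + 1)) ξ
    rw [show k + 1 + (k' - (k + 1)) = k' by omega, h0', walk, Finset.sum_range_succ] at this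
    change 0 = walk k ξ + _ + _ at this
    rw [h0, h1, zero_add] at this
    exact neg_add_eq_zero.1 this.symm |>.symm
  have hsum : ∑ k ∈ Finset.range (m + 1), stepsLaw.real (F k) ≤ 1 := by
    rw [← measureReal_biUnion_finset]
    · exact measureReal_le_one
    · intro k hk k' hk' hne
      simp at hk hk'
      rcases lt_or_gt_of_ne hne with h | h
      · exact hdisj k k' h (by omega)
      · exact (hdisj k' k h (by omega)).symm
    · exact fun k _ => measurableSet_of_dependsOn (hd3 k)
  simp only [hF] at hsum
  rw [← Finset.sum_mul] at hsum
  change greenSum m * _ ≤ 1 at hsum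
  linarith

/-- In the rotated coordinates `x + y` and `x - y` the walk is a pair of independent one-dimensional
simple walks, with `i` and `j` up-steps. Only the lower bound is needed; it follows by induction
from Pascal's rule applied to both factors, whose four terms match the four last steps. -/
theorem choose_mul_choose_le_walk_eq (n : ℕ) : ∀ (x y : ℤ) (i j : ℕ), x + y = 2 * i - n →
    x - y = 2 * j - n →
    (n.choose i * n.choose j : ℝ) / 4 ^ n ≤ stepsLaw.real {ξ | walk n ξ = (x, y)} := by
  induction n with
  | zero =>
    intro x y i j hi hj
    rcases i with _ | i
    · rcases j with _ | j
      · obtain rfl : x = 0 := by simp at hi hj; omega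
        obtain rfl : y = 0 := by simp at hi hj; omega
        have : {ξ : ℕ → ℤ × ℤ | walk 0 ξ = (0, 0)} = Set.univ := by
          ext ξ; simp [walk]; rfl
        simp [this]
      · simp
    · simp
  | succ n ih =>
    intro x y i j hi hj
    push_cast at hi hj
    let F : ℤ × ℤ → Set (ℕ → ℤ × ℤ) := fun e => {ξ | walk n ξ = (x, y) - e} ∩ {ξ | ξ n = e}
    have hF : ∀ e ∈ unitSteps, stepsLaw.real (F e) =
        stepsLaw.real {ξ | walk n ξ = (x, y) - e} * (1 / 4) := fun e he => by
      rw [stepsLaw_real_inter (S := Finset.range n) (T := {n}) (by simp)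
        (dependsOn_walk_eq n _) (dependsOn_step_eq n e), stepsLaw_real_step_eq n he]
    have hsum : ∑ e ∈ unitSteps, stepsLaw.real (F e) ≤
        stepsLaw.real {ξ | walk (n + 1) ξ = (x, y)} := by
      rw [← measureReal_biUnion_finset]
      · refine measureReal_mono ?_
        intro ξ hξ
        simp only [Set.mem_iUnion] at hξ
        obtain ⟨e, -, h1, h2⟩ := hξ
        simp only [Set.mem_ofPred_eq] at h1 h2 ⊢
        rw [walk, Finset.sum_range_succ]
        change walk n ξ + _ = _
        rw [h1, h2]; abel
      · intro e _ e' _ hne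
        refine Set.disjoint_left.2 ?_
        rintro ξ ⟨-, h⟩ ⟨-, h'⟩
        exact hne (Eq.trans (Eq.symm h) h')
      · exact fun e _ => measurableSet_of_dependsOn
          (dependsOn_inter (dependsOn_walk_eq n _) (dependsOn_step_eq n e))
    rw [Finset.sum_congr rfl hF, ← Finset.sum_mul] at hsum
    simp only [unitSteps] at hsum
    rw [Finset.sum_insert (by decide), Finset.sum_insert (by decide),
      Finset.sum_insert (by decide), Finset.sum_singleton] at hsum
    simp only [Prod.mk_sub_mk, sub_zero, sub_neg_eq_add] at hsum
    have key : ((n + 1).choose i * (n + 1).choose j : ℝ) / 4 ^ n ≤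
        stepsLaw.real {ξ | walk n ξ = (x - 1, y)} + (stepsLaw.real {ξ | walk n ξ = (x + 1, y)} +
        (stepsLaw.real {ξ | walk n ξ = (x, y - 1)} +
          stepsLaw.real {ξ | walk n ξ = (x, y + 1)})) := by
      have p1 : 0 ≤ stepsLaw.real {ξ | walk n ξ = (x - 1, y)} := measureReal_nonneg
      have p2 : 0 ≤ stepsLaw.real {ξ | walk n ξ = (x + 1, y)} := measureReal_nonneg
      have p3 : 0 ≤ stepsLaw.real {ξ | walk n ξ = (x, y - 1)} := measureReal_nonneg
      have p4 : 0 ≤ stepsLaw.real {ξ | walk n ξ = (x, y + 1)} := measureReal_nonneg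
      rcases i with _ | i
      · rcases j with _ | j
        · have := ih (x + 1) y 0 0 (by push_cast at *; omega) (by push_cast at *; omega)
          simp only [Nat.choose_zero_right] at this ⊢
          linarith
        · have h1 := ih (x + 1) y 0 (j + 1) (by push_cast at *; omega) (by push_cast at *; omega)
          have h2 := ih x (y + 1) 0 j (by push_cast at *; omega) (by push_cast at *; omega)
          simp only [Nat.choose_zero_right, Nat.choose_succ_succ' n j] at *
          push_cast
          rw [mul_add, add_div]
          linarith
      · rcases j with _ | j
        · have h1 := ih (x + 1) y (i + 1) 0 (by push_cast at *; omega) (by push_cast at *; omega)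
          have h2 := ih x (y - 1) i 0 (by push_cast at *; omega) (by push_cast at *; omega)
          simp only [Nat.choose_zero_right, Nat.choose_succ_succ' n i] at *
          push_cast
          rw [add_mul, add_div]
          linarith
        · have h1 := ih (x + 1) y (i + 1) (j + 1) (by push_cast at *; omega)
            (by push_cast at *; omega)
          have h2 := ih x (y - 1) i (j + 1) (by push_cast at *; omega) (by push_cast at *; omega)
          have h3 := ih x (y + 1) (i + 1) j (by push_cast at *; omega) (by push_cast at *; omega)
          have h4 := ih (x - 1) y i j (by push_cast at *; omega) (by push_cast at *; omega)
          simp only [Nat.choose_succ_succ' n] at *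
          push_cast
          rw [add_mul, mul_add, mul_add, add_div, add_div, add_div]
          linarith
    rw [pow_succ, ← div_div]
    linarith

/-- The elementary form of `centralBinom k ≥ 4 ^ k / (2 √k)`; the induction step reduces to `(k +
1)(k + 2) ≤ (k + 3/2) ^ 2`. -/
theorem sixteen_pow_le (k : ℕ) : 16 ^ (k + 1) ≤ 4 * (k + 1) * (k + 1).centralBinom ^ 2 := by
  induction k with
  | zero => simp [Nat.centralBinom, Nat.choose]
  | succ k ih =>
    have h := Nat.succ_mul_centralBinom_succ (k + 1)
    refine Nat.le_of_mul_le_mul_left ?_ (show 0 < (k + 1 + 1) by omega)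
    calc (k + 1 + 1) * 16 ^ (k + 1 + 1) = 16 * (k + 2) * 16 ^ (k + 1) := by ring
      _ ≤ 16 * (k + 2) * (4 * (k + 1) * (k + 1).centralBinom ^ 2) := Nat.mul_le_mul_left _ ih
      _ ≤ 4 * (2 * (2 * (k + 1) + 1) * (k + 1).centralBinom) ^ 2 := by
        have : 16 * (k + 2) * (4 * (k + 1)) ≤ 4 * (2 * (2 * (k + 1) + 1)) ^ 2 := by nlinarith
        calc _ = 16 * (k + 2) * (4 * (k + 1)) * (k + 1).centralBinom ^ 2 := by ring
          _ ≤ 4 * (2 * (2 * (k + 1) + 1)) ^ 2 * (k + 1).centralBinom ^ 2 :=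
            Nat.mul_le_mul_right _ this
          _ = _ := by ring
      _ = _ := by rw [← h]; ring

theorem walk_return_ge (k : ℕ) :
    1 / (4 * (k + 1) : ℝ) ≤ stepsLaw.real {ξ | walk (2 * (k + 1)) ξ = 0} := by
  refine le_trans ?_ (choose_mul_choose_le_walk_eq (2 * (k + 1)) 0 0 (k + 1) (k + 1)
    (by push_cast; ring) (by push_cast; ring))
  rw [div_le_div_iff₀ (by positivity) (by positivity)]
  have h : ((16 ^ (k + 1) : ℕ) : ℝ) ≤ _ := Nat.cast_le.2 (sixteen_pow_le k)
  rw [Nat.centralBinom] at h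
  push_cast at h
  rw [pow_mul]
  norm_num
  linarith

theorem greenSum_succ (m : ℕ) :
    greenSum (m + 1) = greenSum m + stepsLaw.real {ξ | walk (m + 1) ξ = 0} :=
  Finset.sum_range_succ _ _

/-- The even return probabilities dominate a quarter of the harmonic series. -/
theorem log_le_greenSum (m : ℕ) : Real.log (m + 1) / 4 ≤ greenSum (2 * m) := by
  induction m with
  | zero =>
    have : 0 ≤ greenSum 0 := Finset.sum_nonneg fun i _ => measureReal_nonneg
    simpa using this
  | succ m ih =>
    have h1 : greenSum (2 * m) + 1 / (4 * (m + 1)) ≤ greenSum (2 * (m + 1)) := by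
      have h2 := walk_return_ge m
      have h3 : 0 ≤ stepsLaw.real {ξ | walk (2 * m + 1) ξ = 0} := measureReal_nonneg
      have h4 := greenSum_succ (2 * m)
      have h5 := greenSum_succ (2 * m + 1)
      rw [show 2 * m + 1 + 1 = 2 * (m + 1) by ring] at h5
      linarith
    have h4 : Real.log ((m + 1 : ℕ) + 1) ≤ Real.log (m + 1) + 1 / (m + 1) := by
      have hm : (0 : ℝ) < m + 1 := by positivity
      have := Real.log_le_sub_one_of_pos (show (0 : ℝ) < (m + 1 + 1) / (m + 1) by positivity)
      rw [Real.log_div (by positivity) (by positivity)] at this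
      have h5 : ((m : ℝ) + 1 + 1) / (m + 1) - 1 = 1 / (m + 1) := by field_simp; ring
      push_cast
      linarith
    have h6 : (1 : ℝ) / (4 * (m + 1)) = 1 / (m + 1) / 4 := by rw [div_div, mul_comm]
    linarith

theorem greenSum_mono : Monotone greenSum := fun a b h =>
  Finset.sum_le_sum_of_subset_of_nonneg (by simpa using h) fun _ _ _ => measureReal_nonneg

theorem log_mul_avoid_le {e : ℤ × ℤ} (he : e ∈ unitSteps) (m : ℕ) :
    Real.log m * stepsLaw.real (avoid e m) ≤ 32 := by
  rcases Nat.eq_zero_or_pos m with rfl | hm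
  · simp
  have h1 := greenSum_mul_avoid_le he m
  have h2 : Real.log m / 8 ≤ greenSum m := by
    refine le_trans ?_ ((log_le_greenSum (m / 2)).trans (greenSum_mono (by omega)))
    -- Squaring absorbs the passage from `m` to `m / 2` at the cost of a factor 2 in the logarithm,
    -- whence `log m / 8` and the final constant `32 = 4 * 8`.
    have h3 : (m : ℝ) ≤ ((m / 2 : ℕ) + 1) ^ 2 := by
      have : m ≤ (m / 2 + 1) ^ 2 := by
        have : m ≤ 2 * (m / 2) + 1 := by omega
        nlinarith
      exact_mod_cast this
    have h4 := Real.log_le_log (by exact_mod_cast hm) h3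
    rw [Real.log_pow] at h4
    push_cast at h4
    linarith
  have h5 : 0 ≤ stepsLaw.real (avoid e m) := measureReal_nonneg
  nlinarith [mul_le_mul_of_nonneg_right h2 h5]

/-! ### An exponential supermartingale bounding successes by trials -/

/-- The σ-algebras generated by the steps before the times `t n`, for nondecreasing `t`. -/
def stepFiltration (t : ℕ → ℕ) (ht : Monotone t) :
    Filtration ℕ (inferInstance : MeasurableSpace (ℕ → ℤ × ℤ)) where
  seq n := MeasurableSpace.comap (Finset.range (t n)).restrict inferInstance
  mono' i j hij := by
    have h : Finset.range (t i) ⊆ Finset.range (t j) := by simpa using ht hij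
    have h' : (Finset.range (t i)).restrict (π := fun _ => ℤ × ℤ) =
        Finset.restrict₂ h ∘ (Finset.range (t j)).restrict := rfl
    dsimp only
    rw [h', ← MeasurableSpace.comap_comp]
    exact MeasurableSpace.comap_mono (Finset.measurable_restrict₂ h).comap_le
  le' n := (Finset.measurable_restrict _).comap_le

theorem stronglyMeasurable_stepFiltration {t : ℕ → ℕ} (ht : Monotone t) {n : ℕ}
    {f : (ℕ → ℤ × ℤ) → ℝ} (hf : DependsOn f (Finset.range (t n) : Set ℕ)) :
    StronglyMeasurable[stepFiltration t ht n] f := by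
  obtain ⟨g, rfl⟩ := exists_eq_comp_restrict hf
  exact ((measurable_of_countable g).comp (comap_measurable _)).stronglyMeasurable

theorem dependsOn_of_measurableSet_stepFiltration {t : ℕ → ℕ} (ht : Monotone t) {n : ℕ}
    {s : Set (ℕ → ℤ × ℤ)} (hs : MeasurableSet[stepFiltration t ht n] s) :
    DependsOn (· ∈ s) (Finset.range (t n) : Set ℕ) := by
  obtain ⟨u, -, rfl⟩ := hs
  intro x y h
  have : (Finset.range (t n)).restrict x = (Finset.range (t n)).restrict y := by
    funext i; exact h i i.2
  simp only [Set.mem_preimage, this]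

theorem dependsOn_indicator {A : Set (ℕ → ℤ × ℤ)} {S : Set ℕ} {f : (ℕ → ℤ × ℤ) → ℝ}
    (hA : DependsOn (· ∈ A) S) (hf : DependsOn f S) : DependsOn (A.indicator f) S := by
  classical
  intro x y h
  have h1 : (x ∈ A) = (y ∈ A) := hA h
  simp only [Set.indicator_apply, h1, hf h]

theorem dependsOn_indicator_one {A : Set (ℕ → ℤ × ℤ)} {S : Set ℕ}
    (hA : DependsOn (· ∈ A) S) : DependsOn (A.indicator (1 : (ℕ → ℤ × ℤ) → ℝ)) S :=
  dependsOn_indicator hA fun _ _ _ => rfl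

/-- The logarithm of the exponential moment of a Bernoulli variable with mean `p`. -/
def bernoulliCgf (p : ℝ) : ℝ := Real.log (1 + p * (Real.exp 1 - 1))

theorem bernoulliCgf_nonneg {p : ℝ} (hp : 0 ≤ p) : 0 ≤ bernoulliCgf p := by
  refine Real.log_nonneg ?_
  have := Real.add_one_le_exp (1 : ℝ)
  nlinarith

/-- From `log x ≤ x - 1` and `e - 1 ≤ 2`. -/
theorem bernoulliCgf_le {p : ℝ} (hp : 0 ≤ p) : bernoulliCgf p ≤ 2 * p := by
  have h1 := Real.add_one_le_exp (1 : ℝ)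
  have h2 := Real.exp_one_lt_d9
  refine (Real.log_le_sub_one_of_pos (by nlinarith)).trans ?_
  nlinarith

theorem bernoulliCgf_lt_one {p : ℝ} (hp : 0 ≤ p) (hp1 : p < 1) : bernoulliCgf p < 1 := by
  have h1 := Real.add_one_le_exp (1 : ℝ)
  rw [bernoulliCgf, Real.log_lt_iff_lt_exp (by nlinarith)]
  nlinarith

variable {D : ℕ → Set (ℕ → ℤ × ℤ)} {G : Set (ℕ → ℤ × ℤ)} {T : ℕ}

/-- `1` if `D k` occurs and the steps from time `k` on lie in `G`. -/
def success (D : ℕ → Set (ℕ → ℤ × ℤ)) (G : Set (ℕ → ℤ × ℤ)) (k : ℕ) : (ℕ → ℤ × ℤ) → ℝ :=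
  (D k ∩ shift k ⁻¹' G).indicator 1

/-- `1` if `D k` occurs. -/
def trial (D : ℕ → Set (ℕ → ℤ × ℤ)) (k : ℕ) : (ℕ → ℤ × ℤ) → ℝ :=
  (D k).indicator 1

theorem trial_nonneg (k : ℕ) (ξ : ℕ → ℤ × ℤ) : 0 ≤ trial D k ξ :=
  Set.indicator_nonneg (fun _ _ => zero_le_one) ξ

theorem success_le_one (k : ℕ) (ξ : ℕ → ℤ × ℤ) : success D G k ξ ≤ 1 :=
  Set.indicator_apply_le' (fun _ => le_rfl) fun _ => zero_le_one

theorem success_nonneg (k : ℕ) (ξ : ℕ → ℤ × ℤ) : 0 ≤ success D G k ξ :=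
  Set.indicator_nonneg (fun _ _ => zero_le_one) ξ

theorem dependsOn_trial (hD : ∀ k, DependsOn (· ∈ D k) (Finset.range k : Set ℕ)) (k : ℕ) :
    DependsOn (trial D k) (Finset.range k : Set ℕ) := dependsOn_indicator_one (hD k)

theorem dependsOn_success (hD : ∀ k, DependsOn (· ∈ D k) (Finset.range k : Set ℕ))
    (hG : DependsOn (· ∈ G) (Finset.range T : Set ℕ)) (k : ℕ) :
    DependsOn (success D G k) (Finset.range (k + T) : Set ℕ) := by
  refine dependsOn_indicator_one
    ((dependsOn_inter (hD k) (dependsOn_shift hG k)).mono fun i hi => ?_)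
  simp at hi ⊢
  omega

/-- The exponential supermartingale of the successes along the times `r + i * T`. -/
def expWeight (D : ℕ → Set (ℕ → ℤ × ℤ)) (G : Set (ℕ → ℤ × ℤ)) (c : ℝ) (T r n : ℕ)
    (ξ : ℕ → ℤ × ℤ) : ℝ :=
  Real.exp (∑ i ∈ Finset.range n, (success D G (r + i * T) ξ - c * trial D (r + i * T) ξ))

theorem dependsOn_expWeight (hD : ∀ k, DependsOn (· ∈ D k) (Finset.range k : Set ℕ))
    (hG : DependsOn (· ∈ G) (Finset.range T : Set ℕ)) (c : ℝ) (r n : ℕ) :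
    DependsOn (expWeight D G c T r n) (Finset.range (r + n * T) : Set ℕ) := by
  intro x y h
  unfold expWeight
  congr 1
  refine Finset.sum_congr rfl fun i hi => ?_
  have hi' : i + 1 ≤ n := by simpa using hi
  have h1 : (i + 1) * T ≤ n * T := Nat.mul_le_mul_right T hi'
  rw [add_mul, one_mul] at h1
  rw [dependsOn_success hD hG _ fun j hj => h j ?_, dependsOn_trial hD _ fun j hj => h j ?_]
  · simp at hj ⊢; omega
  · simp at hj ⊢; omega

theorem expWeight_le {c : ℝ} (hc : 0 ≤ c) (r n : ℕ) (ξ : ℕ → ℤ × ℤ) :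
    expWeight D G c T r n ξ ≤ Real.exp n := by
  refine Real.exp_le_exp.2 ?_
  calc _ ≤ ∑ i ∈ Finset.range n, (1 : ℝ) := Finset.sum_le_sum fun i _ => by
        have := success_le_one (D := D) (G := G) (r + i * T) ξ
        have := mul_nonneg hc (trial_nonneg (D := D) (r + i * T) ξ)
        linarith
    _ = n := by simp

theorem integrable_of_dependsOn {f : (ℕ → ℤ × ℤ) → ℝ} {S : Finset ℕ}
    (hf : DependsOn f (S : Set ℕ)) {C : ℝ} (hC : ∀ ξ, |f ξ| ≤ C) : Integrable f stepsLaw :=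
  Integrable.of_bound (measurable_of_dependsOn hf).aestronglyMeasurable C
    (Eventually.of_forall hC)

/-- The spacing `T` makes each success known before the next trial starts. Given the past, a trial
multiplies the weight by a factor of mean `exp (-c) * (1 + p (e - 1)) = 1`, by the choice of `c`;
without a trial the weight is unchanged. -/
theorem supermartingale_expWeight (hD : ∀ k, DependsOn (· ∈ D k) (Finset.range k : Set ℕ))
    (hG : DependsOn (· ∈ G) (Finset.range T : Set ℕ)) (r : ℕ)
    (ht : Monotone fun n => r + n * T) :
    Supermartingale (expWeight D G (bernoulliCgf (stepsLaw.real G)) T r)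
      (stepFiltration (fun n => r + n * T) ht) stepsLaw := by
  set c := bernoulliCgf (stepsLaw.real G) with hc
  have hc0 : 0 ≤ c := bernoulliCgf_nonneg measureReal_nonneg
  have hZ := dependsOn_expWeight hD hG c r
  have hZpos : ∀ n ξ, 0 ≤ expWeight D G c T r n ξ := fun n ξ => (Real.exp_pos _).le
  have hint : ∀ n, Integrable (expWeight D G c T r n) stepsLaw := fun n =>
    integrable_of_dependsOn (hZ n) (C := Real.exp n) fun ξ => by
      rw [abs_of_nonneg (hZpos n ξ)]; exact expWeight_le hc0 r n ξ
  refine supermartingale_of_setIntegral_succ_le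
    (fun n => stronglyMeasurable_stepFiltration ht (hZ n)) hint fun n s hs => ?_
  have hs' := dependsOn_of_measurableSet_stepFiltration ht hs
  have hsm : MeasurableSet s := (stepFiltration _ ht).le n s hs
  rw [← sub_nonpos, ← integral_sub (hint _).integrableOn (hint _).integrableOn,
    ← integral_indicator hsm]
  set k := r + n * T with hk
  -- The relative increment of the weight when a trial takes place. The increment on `s` is then a
  -- nonnegative function `f` of the past times `g` of the future.
  let g : (ℕ → ℤ × ℤ) → ℝ := fun ξ => Real.exp (-c) * (1 + (Real.exp 1 - 1) * G.indicator 1 ξ) - 1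
  let f : (ℕ → ℤ × ℤ) → ℝ := (s ∩ D k).indicator (expWeight D G c T r n)
  have hg : DependsOn g (Finset.range T : Set ℕ) := fun x y h => by
    simp only [g, dependsOn_indicator_one hG h]
  have hf : DependsOn f (Finset.range k : Set ℕ) := by
    refine dependsOn_indicator ?_ (hZ n)
    simpa using dependsOn_inter hs' (hD k)
  have hfg : s.indicator (fun ξ => expWeight D G c T r (n + 1) ξ - expWeight D G c T r n ξ) =
      fun ξ => f ξ * g (shift k ξ) := by
    funext ξ
    by_cases h1 : ξ ∈ s
    · have e1 : expWeight D G c T r (n + 1) ξ =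
          expWeight D G c T r n ξ * Real.exp (success D G k ξ - c * trial D k ξ) := by
        rw [expWeight, Finset.sum_range_succ, Real.exp_add]; rfl
      by_cases h2 : ξ ∈ D k
      · by_cases h3 : shift k ξ ∈ G
        · have h4 : success D G k ξ = 1 := Set.indicator_of_mem (show _ ∈ D k ∩ _ from ⟨h2, h3⟩) _
          have h5 : trial D k ξ = 1 := Set.indicator_of_mem h2 _
          simp only [Set.indicator_of_mem h1, e1, h4, h5, f, g, Set.indicator_of_mem h3,
            Set.indicator_of_mem (show ξ ∈ s ∩ D k from ⟨h1, h2⟩), Pi.one_apply, sub_eq_add_neg,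
            Real.exp_add]
          ring_nf
        · have h4 : success D G k ξ = 0 :=
            Set.indicator_of_notMem (fun h => h3 h.2) _
          have h5 : trial D k ξ = 1 := Set.indicator_of_mem h2 _
          simp only [Set.indicator_of_mem h1, e1, h4, h5, f, g, Set.indicator_of_notMem h3,
            Set.indicator_of_mem (show ξ ∈ s ∩ D k from ⟨h1, h2⟩)]
          ring_nf
      · have h4 : success D G k ξ = 0 := Set.indicator_of_notMem (fun h => h2 h.1) _
        have h5 : trial D k ξ = 0 := Set.indicator_of_notMem h2 _
        have h6 : f ξ = 0 := Set.indicator_of_notMem (fun h => h2 h.2) _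
        simp [Set.indicator_of_mem h1, e1, h4, h5, h6]
    · have h6 : f ξ = 0 := Set.indicator_of_notMem (fun h => h1 h.1) _
      simp [Set.indicator_of_notMem h1, h6]
  have hEg : ∫ ξ, g (shift k ξ) ∂stepsLaw ≤ 0 := by
    have e1 : ∫ ξ, g (shift k ξ) ∂stepsLaw = ∫ ξ, g ξ ∂stepsLaw := by
      conv_rhs => rw [← (measurePreserving_shift k).map_eq]
      exact (integral_map (measurePreserving_shift k).measurable.aemeasurable
        (measurable_of_dependsOn hg).aestronglyMeasurable).symm
    have hGm := measurableSet_of_dependsOn hG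
    have hGi : Integrable (G.indicator (1 : (ℕ → ℤ × ℤ) → ℝ)) stepsLaw :=
      (integrable_const (1 : ℝ)).indicator hGm
    have e2 : ∫ ξ, g ξ ∂stepsLaw =
        Real.exp (-c) * (1 + (Real.exp 1 - 1) * stepsLaw.real G) - 1 := by
      have hi : Integrable (fun ξ => 1 + (Real.exp 1 - 1) * G.indicator 1 ξ) stepsLaw :=
        (integrable_const _).add (hGi.const_mul _)
      simp only [g]
      rw [integral_sub (hi.const_mul _) (integrable_const _), integral_const_mul,
        integral_add (integrable_const _) (hGi.const_mul _), integral_const_mul,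
        integral_indicator_one hGm]
      simp
    have h1 : (1 : ℝ) ≤ Real.exp 1 - 1 := by linarith [Real.add_one_le_exp (1 : ℝ)]
    have h2 : Real.exp c = 1 + stepsLaw.real G * (Real.exp 1 - 1) := by
      rw [hc, bernoulliCgf, Real.exp_log]
      have : 0 ≤ stepsLaw.real G := measureReal_nonneg
      nlinarith
    rw [e1, e2, mul_comm (Real.exp 1 - 1), ← h2, ← Real.exp_add]
    simp
  rw [hfg, (indepFun_of_dependsOn (S := Finset.range k) (T := Finset.Ico k (k + T)) ?_ hf
    (dependsOn_shift hg k)).integral_fun_mul_eq_mul_integral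
    (measurable_of_dependsOn hf).aestronglyMeasurable
    (measurable_of_dependsOn (dependsOn_shift hg k)).aestronglyMeasurable]
  · exact mul_nonpos_of_nonneg_of_nonpos
      (integral_nonneg fun ξ => Set.indicator_nonneg (fun ξ _ => hZpos n ξ) ξ) hEg
  · rw [Finset.disjoint_left]; intro i hi; simp at hi ⊢; omega

/-- The supermartingale is nonnegative with initial value 1, hence bounded in `L¹` and almost surely
convergent. It is therefore bounded along almost every path, and the logarithm of the bound is the
constant `K`. -/
theorem ae_exists_sum_success_le_residue
    (hD : ∀ k, DependsOn (· ∈ D k) (Finset.range k : Set ℕ))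
    (hG : DependsOn (· ∈ G) (Finset.range T : Set ℕ)) (r : ℕ) :
    ∀ᵐ ξ ∂stepsLaw, ∃ K : ℝ, ∀ n, ∑ i ∈ Finset.range n, success D G (r + i * T) ξ ≤
      bernoulliCgf (stepsLaw.real G) * ∑ i ∈ Finset.range n, trial D (r + i * T) ξ + K := by
  have ht : Monotone fun n => r + n * T := fun a b h =>
    Nat.add_le_add_left (Nat.mul_le_mul_right T h) r
  have hM := supermartingale_expWeight hD hG r ht
  set c := bernoulliCgf (stepsLaw.real G) with hc
  have hbdd : ∀ n, eLpNorm ((-expWeight D G c T r) n) 1 stepsLaw ≤ (1 : NNReal) := by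
    intro n
    have h0 : ∫ ξ, expWeight D G c T r n ξ ∂stepsLaw ≤ 1 := by
      have := hM.setIntegral_le (Nat.zero_le n) MeasurableSet.univ
      simpa [expWeight] using this
    rw [Pi.neg_apply, eLpNorm_neg, eLpNorm_one_eq_lintegral_enorm,
      ← ofReal_integral_norm_eq_lintegral_enorm (hM.integrable n)]
    refine ENNReal.ofReal_le_of_le_toReal ?_
    refine le_trans (le_of_eq ?_) h0
    refine integral_congr_ae (Eventually.of_forall fun ξ => ?_)
    exact Real.norm_of_nonneg (Real.exp_pos _).le
  filter_upwards [hM.neg.exists_ae_tendsto_of_bdd hbdd] with ξ ⟨a, ha⟩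
  obtain ⟨M, hM'⟩ := ha.neg.bddAbove_range
  refine ⟨Real.log (max M 1), fun n => ?_⟩
  have h1 : expWeight D G c T r n ξ ≤ max M 1 := by
    have := hM' ⟨n, rfl⟩
    simp at this
    exact le_max_of_le_left this
  rw [expWeight, ← Real.le_log_iff_exp_le (by positivity), Finset.sum_sub_distrib,
    ← Finset.mul_sum] at h1
  linarith

theorem sum_range_mul_eq (f : ℕ → ℝ) (n T : ℕ) :
    ∑ k ∈ Finset.range (n * T), f k =
      ∑ r ∈ Finset.range T, ∑ i ∈ Finset.range n, f (r + i * T) := by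
  induction n with
  | zero => simp
  | succ n ih =>
    rw [add_mul, one_mul, Finset.sum_range_add, ih]
    simp only [Finset.sum_range_succ, Finset.sum_add_distrib, add_comm (n * T)]

/-- If `G` depends on finitely many steps, the number of successes among the trials `D k` is at
most a constant multiple of the number of trials, up to a random additive constant. -/
theorem ae_exists_sum_success_le
    (hD : ∀ k, DependsOn (· ∈ D k) (Finset.range k : Set ℕ))
    (hT : 0 < T) (hG : DependsOn (· ∈ G) (Finset.range T : Set ℕ)) :
    ∀ᵐ ξ ∂stepsLaw, ∃ K : ℝ, ∀ n, ∑ k ∈ Finset.range n, success D G k ξ ≤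
      bernoulliCgf (stepsLaw.real G) * ∑ k ∈ Finset.range n, trial D k ξ + K := by
  filter_upwards [ae_all_iff.2 fun r => ae_exists_sum_success_le_residue hD hG r] with ξ hξ
  choose K hK using hξ
  refine ⟨∑ r ∈ Finset.range T, K r + T, fun n => ?_⟩
  have hc : 0 ≤ bernoulliCgf (stepsLaw.real G) := bernoulliCgf_nonneg measureReal_nonneg
  have h1 : ∑ k ∈ Finset.range (n / T * T), success D G k ξ ≤
      bernoulliCgf (stepsLaw.real G) * ∑ k ∈ Finset.range (n / T * T), trial D k ξ +
        ∑ r ∈ Finset.range T, K r := by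
    rw [sum_range_mul_eq, sum_range_mul_eq, Finset.mul_sum, ← Finset.sum_add_distrib]
    exact Finset.sum_le_sum fun r _ => hK r _
  have h2 : ∑ k ∈ Finset.range (n / T * T), trial D k ξ ≤ ∑ k ∈ Finset.range n, trial D k ξ :=
    Finset.sum_le_sum_of_subset_of_nonneg (by simpa using Nat.div_mul_le_self n T)
      fun k _ _ => trial_nonneg k ξ
  -- The incomplete last block has fewer than `T` terms, each at most 1.
  have h3 : ∑ k ∈ Finset.range n, success D G k ξ ≤
      ∑ k ∈ Finset.range (n / T * T), success D G k ξ + T := by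
    have e : n = n / T * T + n % T := by rw [mul_comm]; exact (Nat.div_add_mod n T).symm
    conv_lhs => rw [e, Finset.sum_range_add]
    gcongr
    refine (Finset.sum_le_sum fun k _ => success_le_one _ ξ).trans ?_
    simpa using (Nat.mod_lt n hT).le
  have := mul_le_mul_of_nonneg_left h2 hc
  linarith

/-! ### Missed neighbours and the second moment of the boundary size -/

/-- The event that the neighbour in direction `e` of the position at time `k` is not visited up to
time `n`. -/
def missed (e : ℤ × ℤ) (n k : ℕ) : Set (ℕ → ℤ × ℤ) := {ξ | ∀ j ≤ n, walk j ξ ≠ walk k ξ + e}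

theorem dependsOn_missed (e : ℤ × ℤ) {n k : ℕ} (hk : k ≤ n) :
    DependsOn (· ∈ missed e n k) (Finset.range n : Set ℕ) := by
  intro x y h
  have h' : ∀ j ≤ n, walk j x = walk j y := fun j hj =>
    dependsOn_walk j fun i hi => h i (by simp at hi ⊢; omega)
  simp only [missed, Set.mem_ofPred_eq, eq_iff_iff]
  exact forall₂_congr fun j hj => by rw [h' j hj, h' k hk]

theorem shift_mem_avoid {e : ℤ × ℤ} {n k : ℕ} {ξ : ℕ → ℤ × ℤ} (hξ : ξ ∈ missed e n k) {m : ℕ}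
    (hm : k + m ≤ n) : shift k ξ ∈ avoid e m := fun j hj h =>
  hξ (k + j) (by omega) (by rw [walk_add, h])

theorem reverse_mem_avoid {e : ℤ × ℤ} {n k : ℕ} {ξ : ℕ → ℤ × ℤ} (hξ : ξ ∈ missed e n k) {m : ℕ}
    (hm : m ≤ k) (hk : k ≤ n) : reverse k ξ ∈ avoid (-e) m := fun j hj h =>
  hξ (k - j) (by omega) (by rw [walk_sub (hj.trans hm), h, sub_neg_eq_add])

/-- The four factors come from disjoint blocks of steps: `[0, k)` reversed, `[k, k + a)`, `[l - b,
l)` reversed, and `[l, n)`. -/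
theorem missed_inter_le (e e' : ℤ × ℤ) {n k l a b : ℕ} (hkl : k + a + b = l) (hln : l ≤ n) :
    stepsLaw.real (missed e n k ∩ missed e' n l) ≤
      stepsLaw.real (avoid (-e) k) * (stepsLaw.real (avoid e a) *
        (stepsLaw.real (avoid (-e') b) * stepsLaw.real (avoid e' (n - l)))) := by
  have h1 := dependsOn_reverse le_rfl (dependsOn_avoid (-e) k)
  have h2 := dependsOn_shift (dependsOn_avoid e a) k
  have h3 := dependsOn_reverse (show b ≤ l by omega) (dependsOn_avoid (-e') b)
  have h4 := dependsOn_shift (dependsOn_avoid e' (n - l)) l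
  change DependsOn (· ∈ reverse k ⁻¹' avoid (-e) k) _ at h1
  change DependsOn (· ∈ shift k ⁻¹' avoid e a) _ at h2
  change DependsOn (· ∈ reverse l ⁻¹' avoid (-e') b) _ at h3
  change DependsOn (· ∈ shift l ⁻¹' avoid e' (n - l)) _ at h4
  rw [← stepsLaw_real_reverse (dependsOn_avoid (-e) k) k,
    ← stepsLaw_real_shift (dependsOn_avoid e a) k,
    ← stepsLaw_real_reverse (dependsOn_avoid (-e') b) l,
    ← stepsLaw_real_shift (dependsOn_avoid e' (n - l)) l,
    ← stepsLaw_real_inter ?_ h3 h4, ← stepsLaw_real_inter ?_ h2 (dependsOn_inter h3 h4),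
    ← stepsLaw_real_inter ?_ h1 (dependsOn_inter h2 (dependsOn_inter h3 h4))]
  · refine measureReal_mono ?_
    rintro ξ ⟨hξ, hξ'⟩
    exact ⟨reverse_mem_avoid hξ le_rfl (by omega), shift_mem_avoid hξ (by omega),
      reverse_mem_avoid hξ' (by omega) hln, shift_mem_avoid hξ' (by omega)⟩
  all_goals rw [Finset.disjoint_left]; intro i hi; simp at hi ⊢; omega

theorem avoid_le {e : ℤ × ℤ} (he : e ∈ unitSteps) {s m : ℕ} (hs : 2 ≤ s) (hm : s ≤ m) :
    stepsLaw.real (avoid e m) ≤ 32 / Real.log s := by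
  rw [le_div_iff₀ (Real.log_pos (by exact_mod_cast hs)), mul_comm]
  refine le_trans ?_ (log_mul_avoid_le he s)
  exact mul_le_mul_of_nonneg_left (measureReal_mono (avoid_antitone e hm))
    (Real.log_natCast_nonneg s)

theorem missed_inter_le_of_gaps {e e' : ℤ × ℤ} (he : e ∈ unitSteps) (he' : e' ∈ unitSteps)
    {n k l s : ℕ} (hs : 2 ≤ s) (hk : s ≤ k) (hkl : k + 2 * s ≤ l) (hl : l + s ≤ n) :
    stepsLaw.real (missed e n k ∩ missed e' n l) ≤ (32 / Real.log s) ^ 4 := by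
  refine (missed_inter_le e e' (a := s) (b := l - k - s) (by omega) (by omega)).trans ?_
  have h0 : 0 ≤ 32 / Real.log s := div_nonneg (by norm_num) (Real.log_natCast_nonneg s)
  calc _ ≤ (32 / Real.log s) * ((32 / Real.log s) * ((32 / Real.log s) * (32 / Real.log s))) := by
        gcongr
        · exact avoid_le (neg_mem_unitSteps he) hs hk
        · exact avoid_le he hs le_rfl
        · exact avoid_le (neg_mem_unitSteps he') hs (by omega)
        · exact avoid_le he' hs (by omega)
    _ = _ := by ring

theorem sum_ite_lt_add_le (n s : ℕ) :
    ∑ k ∈ Finset.range (n + 1), (if n < k + s then (1 : ℝ) else 0) ≤ s := by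
  rw [Finset.sum_boole]
  have : ((Finset.range (n + 1)).filter fun k => n < k + s).card ≤
      (Finset.Ico (n + 1 - s) (n + 1)).card :=
    Finset.card_le_card fun k hk => by simp at hk ⊢; omega
  rw [Nat.card_Ico] at this
  exact_mod_cast this.trans (by omega)

/-- Pairs without the required gaps are bounded by 1. Each of the four end constraints fails for at
most `s (n + 1)` pairs, and `|k - l| < 2 s` holds for at most `4 s (n + 1)`, giving `8 s (n + 1)`.
-/
theorem sum_missed_inter_le {e e' : ℤ × ℤ} (he : e ∈ unitSteps) (he' : e' ∈ unitSteps)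
    (n : ℕ) {s : ℕ} (hs : 2 ≤ s) :
    ∑ k ∈ Finset.range (n + 1), ∑ l ∈ Finset.range (n + 1),
      stepsLaw.real (missed e n k ∩ missed e' n l) ≤
        (n + 1) ^ 2 * (32 / Real.log s) ^ 4 + 8 * s * (n + 1) := by
  have hpt : ∀ k ∈ Finset.range (n + 1), ∀ l ∈ Finset.range (n + 1),
      stepsLaw.real (missed e n k ∩ missed e' n l) ≤ (32 / Real.log s) ^ 4 +
        (if k < s then 1 else 0) + (if l < s then 1 else 0) + (if n < k + s then 1 else 0) +
        (if n < l + s then 1 else 0) + (if k < l + 2 * s ∧ l < k + 2 * s then 1 else 0) := by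
    intro k hk l hl
    have h0 : 0 ≤ (32 / Real.log s) ^ 4 := by positivity
    have h1 : stepsLaw.real (missed e n k ∩ missed e' n l) ≤ 1 := measureReal_le_one
    by_cases hg : s ≤ k ∧ k + 2 * s ≤ l ∧ l + s ≤ n
    · have := missed_inter_le_of_gaps he he' hs hg.1 hg.2.1 hg.2.2
      split_ifs <;> linarith
    by_cases hg' : s ≤ l ∧ l + 2 * s ≤ k ∧ k + s ≤ n
    · have := missed_inter_le_of_gaps he' he hs hg'.1 hg'.2.1 hg'.2.2
      rw [Set.inter_comm] at this
      split_ifs <;> linarith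
    split_ifs <;> first | linarith | omega
  have hc1 : ∑ k ∈ Finset.range (n + 1), (if k < s then (1 : ℝ) else 0) ≤ s := by
    rw [Finset.sum_boole]
    have : ((Finset.range (n + 1)).filter fun k => k < s).card ≤ (Finset.range s).card :=
      Finset.card_le_card fun k hk => by simp at hk ⊢; omega
    rw [Finset.card_range] at this
    exact_mod_cast this
  have hc2 := sum_ite_lt_add_le n s
  have hc3 : ∀ k, ∑ l ∈ Finset.range (n + 1),
      (if k < l + 2 * s ∧ l < k + 2 * s then (1 : ℝ) else 0) ≤ 4 * s := fun k => by
    rw [Finset.sum_boole]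
    have : ((Finset.range (n + 1)).filter fun l => k < l + 2 * s ∧ l < k + 2 * s).card ≤
        (Finset.Ico (k + 1 - 2 * s) (k + 2 * s)).card :=
      Finset.card_le_card fun k hk => by simp at hk ⊢; omega
    rw [Nat.card_Ico] at this
    exact_mod_cast this.trans (by omega)
  refine (Finset.sum_le_sum fun k hk => Finset.sum_le_sum fun l hl => hpt k hk l hl).trans ?_
  simp only [Finset.sum_add_distrib, Finset.sum_const, Finset.card_range, nsmul_eq_mul,
    ← Finset.mul_sum]
  have hc4 := Finset.sum_le_sum fun k (_ : k ∈ Finset.range (n + 1)) => hc3 k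
  rw [Finset.sum_const, Finset.card_range, nsmul_eq_mul] at hc4
  push_cast at *
  have hn : (0 : ℝ) ≤ n + 1 := by positivity
  have h1 := mul_le_mul_of_nonneg_left hc1 hn
  have h2 := mul_le_mul_of_nonneg_left hc2 hn
  linarith

theorem pathOfSteps_zero (ξ : ℕ → ℤ × ℤ) : pathOfSteps 0 ξ = fun n => walk n ξ := by
  funext n; simp [pathOfSteps, walk]

theorem boundarySize_le (n : ℕ) (ξ : ℕ → ℤ × ℤ) :
    (boundarySize latticeGraph (fun j => walk j ξ) n : ℝ) ≤
      ∑ e ∈ unitSteps, ∑ k ∈ Finset.range (n + 1), (missed e n k).indicator 1 ξ := by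
  classical
  have h : innerBoundary latticeGraph (fun j => walk j ξ) n ⊆
      ((unitSteps ×ˢ Finset.range (n + 1)).filter fun p => ξ ∈ missed p.1 n p.2).image
        fun p => walk p.2 ξ := by
    intro x hx
    simp only [innerBoundary, Finset.mem_filter, Set.not_subset] at hx
    obtain ⟨hx, y, hy, hy'⟩ := hx
    simp only [trace, Finset.mem_image, Finset.mem_range] at hx
    obtain ⟨k, hk, rfl⟩ := hx
    simp only [Finset.mem_image, Finset.mem_filter, Finset.mem_product, Finset.mem_range]
    refine ⟨(y - walk k ξ, k), ⟨⟨(adj_iff_sub_mem_unitSteps _ _).1 hy, hk⟩, fun j hj h => ?_⟩, rfl⟩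
    refine hy' ?_
    simp only [trace, Finset.coe_image, Set.mem_image, Finset.coe_range, Set.mem_Iio]
    exact ⟨j, by omega, h.trans (add_sub_cancel _ _)⟩
  have h2 := (Finset.card_le_card h).trans Finset.card_image_le
  rw [← Finset.sum_product']
  calc (boundarySize latticeGraph (fun j => walk j ξ) n : ℝ) ≤ _ := Nat.cast_le.2 h2
    _ = _ := by
      rw [← Finset.sum_boole]
      exact Finset.sum_congr rfl fun p _ => by simp [Set.indicator_apply]

/-- Expanding the square of the bound in `boundarySize_le` gives a sum over pairs of directions and
pairs of times; the factor 16 counts the pairs of directions. -/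
theorem lintegral_boundarySize_sq_le (n : ℕ) {s : ℕ} (hs : 2 ≤ s) :
    ∫⁻ S, (boundarySize latticeGraph S n : ℝ≥0∞) ^ 2 ∂(srwLaw 0) ≤
      ENNReal.ofReal (16 * ((n + 1) ^ 2 * (32 / Real.log s) ^ 4 + 8 * s * (n + 1))) := by
  refine (lintegral_map_le _ _).trans ?_
  change ∫⁻ ξ, _ ∂stepsLaw ≤ _
  simp only [pathOfSteps_zero]
  have hm : ∀ e, ∀ k ∈ Finset.range (n + 1), MeasurableSet (missed e n k) := fun e k hk =>
    measurableSet_of_dependsOn (dependsOn_missed e (by simp at hk; omega))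
  have hsq : ∀ ξ, (∑ e ∈ unitSteps, ∑ k ∈ Finset.range (n + 1),
      (missed e n k).indicator (1 : (ℕ → ℤ × ℤ) → ℝ) ξ) ^ 2 =
      ∑ e ∈ unitSteps, ∑ e' ∈ unitSteps, ∑ k ∈ Finset.range (n + 1), ∑ l ∈ Finset.range (n + 1),
        (missed e n k ∩ missed e' n l).indicator (1 : (ℕ → ℤ × ℤ) → ℝ) ξ := fun ξ => by
    simp only [sq, Finset.sum_mul_sum, Set.inter_indicator_one, Pi.mul_apply]
  have hint : ∀ e e', ∀ k ∈ Finset.range (n + 1), ∀ l ∈ Finset.range (n + 1),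
      Integrable ((missed e n k ∩ missed e' n l).indicator (1 : (ℕ → ℤ × ℤ) → ℝ)) stepsLaw :=
    fun e e' k hk l hl => (integrable_const (1 : ℝ)).indicator ((hm e k hk).inter (hm e' l hl))
  calc ∫⁻ ξ, (boundarySize latticeGraph (fun j => walk j ξ) n : ℝ≥0∞) ^ 2 ∂stepsLaw
      ≤ ∫⁻ ξ, ENNReal.ofReal ((∑ e ∈ unitSteps, ∑ k ∈ Finset.range (n + 1),
          (missed e n k).indicator 1 ξ) ^ 2) ∂stepsLaw := by
        refine lintegral_mono fun ξ => ?_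
        rw [ENNReal.ofReal_pow ((Nat.cast_nonneg _).trans (boundarySize_le n ξ)),
          ← ENNReal.ofReal_natCast]
        gcongr
        exact boundarySize_le n ξ
    _ = ENNReal.ofReal (∑ e ∈ unitSteps, ∑ e' ∈ unitSteps, ∑ k ∈ Finset.range (n + 1),
          ∑ l ∈ Finset.range (n + 1), stepsLaw.real (missed e n k ∩ missed e' n l)) := by
        rw [← ofReal_integral_eq_lintegral_ofReal]
        · congr 1
          simp only [hsq]
          rw [integral_finsetSum _ fun e _ => integrable_finsetSum _ fun e' _ =>
            integrable_finsetSum _ fun k hk => integrable_finsetSum _ fun l hl =>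
              hint e e' k hk l hl]
          refine Finset.sum_congr rfl fun e _ => ?_
          rw [integral_finsetSum _ fun e' _ => integrable_finsetSum _ fun k hk =>
            integrable_finsetSum _ fun l hl => hint e e' k hk l hl]
          refine Finset.sum_congr rfl fun e' _ => ?_
          rw [integral_finsetSum _ fun k hk => integrable_finsetSum _ fun l hl =>
            hint e e' k hk l hl]
          refine Finset.sum_congr rfl fun k hk => ?_
          rw [integral_finsetSum _ fun l hl => hint e e' k hk l hl]
          exact Finset.sum_congr rfl fun l hl =>
            integral_indicator_one ((hm e k hk).inter (hm e' l hl))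
        · simp only [hsq]
          exact integrable_finsetSum _ fun e _ => integrable_finsetSum _ fun e' _ =>
            integrable_finsetSum _ fun k hk => integrable_finsetSum _ fun l hl =>
              hint e e' k hk l hl
        · exact Eventually.of_forall fun ξ => sq_nonneg _
    _ ≤ _ := by
        refine ENNReal.ofReal_le_ofReal ?_
        have hc : unitSteps.card = 4 := by decide
        refine (Finset.sum_le_sum fun e he => Finset.sum_le_sum fun e' he' =>
          sum_missed_inter_le he he' n hs).trans (le_of_eq ?_)
        simp only [Finset.sum_const, hc, nsmul_eq_mul]
        push_cast
        ring

theorem limsup_boundarySize_sq_lt_top :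
    limsup (fun n : ℕ => ENNReal.ofReal (Real.log n ^ 4 / (n : ℝ) ^ 2) *
      ∫⁻ S, (boundarySize latticeGraph S n : ℝ≥0∞) ^ 2 ∂(srwLaw 0)) atTop < ∞ := by
  refine lt_of_le_of_lt (limsup_le_of_le (a := ENNReal.ofReal (64 * 128 ^ 4 + 256 * 16 ^ 4))
    (by isBoundedDefault) ?_) ENNReal.ofReal_lt_top
  filter_upwards [eventually_ge_atTop 4] with n hn
  -- At this scale `log s` is still comparable to `log n` (through `n ≤ s ^ 4`), while the error `s
  -- * n` is negligible against `n ^ 2 / (log n) ^ 4`.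
  set s := Nat.sqrt n with hs
  have hs2 : 2 ≤ s := Nat.le_sqrt.2 (by omega)
  have hsn : s * s ≤ n := Nat.sqrt_le n
  have hns : n ≤ s ^ 4 := by
    have h1 : n < (s + 1) * (s + 1) := Nat.lt_succ_sqrt n
    have h2 : s + 1 ≤ s ^ 2 := by nlinarith
    calc n ≤ (s + 1) * (s + 1) := h1.le
      _ ≤ s ^ 2 * s ^ 2 := Nat.mul_le_mul h2 h2
      _ = s ^ 4 := by ring
  refine (mul_le_mul_right (lintegral_boundarySize_sq_le n hs2) _).trans ?_
  rw [← ENNReal.ofReal_mul (by positivity)]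
  refine ENNReal.ofReal_le_ofReal ?_
  have hnR : (4 : ℝ) ≤ n := by exact_mod_cast hn
  have hsR : (2 : ℝ) ≤ s := by exact_mod_cast hs2
  have hlog : 0 < Real.log n := Real.log_pos (by linarith)
  have hlogs : 0 < Real.log s := Real.log_pos (by linarith)
  have hls : Real.log n ≤ 4 * Real.log s := by
    have := Real.log_le_log (by linarith) (show (n : ℝ) ≤ (s : ℝ) ^ 4 by exact_mod_cast hns)
    rw [Real.log_pow] at this
    exact_mod_cast this
  have h1 : Real.log n * (32 / Real.log s) ≤ 128 := by
    rw [mul_div_assoc', div_le_iff₀ hlogs]; linarith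
  have h2 : (Real.log n * (32 / Real.log s)) ^ 4 ≤ 128 ^ 4 := by gcongr
  have h3 : Real.log n ^ 4 ≤ 16 ^ 4 * (s : ℝ) := by
    -- The exponent `1 / 4` is chosen so that the fourth power of the logarithm is bounded by a
    -- multiple of `s`.
    have h4 := Real.log_le_rpow_div (show (0 : ℝ) ≤ s by linarith) (show (0 : ℝ) < 1 / 4 by norm_num)
    have h5 : Real.log n ≤ 16 * (s : ℝ) ^ (1 / 4 : ℝ) := by linarith
    calc Real.log n ^ 4 ≤ (16 * (s : ℝ) ^ (1 / 4 : ℝ)) ^ 4 := by gcongr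
      _ = 16 ^ 4 * (s : ℝ) := by
        rw [mul_pow, ← Real.rpow_natCast ((s : ℝ) ^ (1 / 4 : ℝ)), ← Real.rpow_mul (by linarith)]
        norm_num
  have h4 : (s : ℝ) * s ≤ n := by exact_mod_cast hsn
  have h5 : Real.log n ^ 4 * s ≤ 16 ^ 4 * n := by
    nlinarith [mul_le_mul_of_nonneg_right h3 (show (0 : ℝ) ≤ s by linarith)]
  rw [div_mul_eq_mul_div, div_le_iff₀ (by positivity)]
  have h6 : ((n : ℝ) + 1) ≤ 2 * n := by linarith
  have h7 : ((n : ℝ) + 1) ^ 2 ≤ 4 * n ^ 2 := by nlinarith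
  rw [mul_pow] at h2
  calc _ = 16 * (((n : ℝ) + 1) ^ 2 * (Real.log n ^ 4 * (32 / Real.log s) ^ 4)) +
        128 * ((Real.log n ^ 4 * s) * (n + 1)) := by ring
    _ ≤ 16 * ((4 * n ^ 2) * 128 ^ 4) + 128 * ((16 ^ 4 * n) * (2 * n)) := by gcongr
    _ = _ := by ring

/-! ### Almost sure comparison of the boundary with the range -/

theorem stepsLaw_real_compl {A : Set (ℕ → ℤ × ℤ)} (hA : MeasurableSet A) :
    stepsLaw.real Aᶜ = 1 - stepsLaw.real A := by
  rw [measureReal_compl hA]; simp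

theorem dependsOn_compl {A : Set (ℕ → ℤ × ℤ)} {S : Set ℕ} (hA : DependsOn (· ∈ A) S) :
    DependsOn (· ∈ Aᶜ) S := fun _ _ h => by
  have := hA h
  simp only [Set.mem_compl_iff] at *
  rw [this]

theorem dependsOn_missed_self (e : ℤ × ℤ) (k : ℕ) :
    DependsOn (· ∈ missed e k k) (Finset.range k : Set ℕ) := dependsOn_missed e le_rfl

theorem walk_succ (k : ℕ) (ξ : ℕ → ℤ × ℤ) : walk (k + 1) ξ = walk k ξ + ξ k :=
  Finset.sum_range_succ _ _

theorem mem_trace {V : Type*} {S : ℕ → V} {n : ℕ} {x : V} :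
    x ∈ trace S n ↔ ∃ k ≤ n, S k = x := by
  simp [trace]

theorem rangeSize_mono {V : Type*} (S : ℕ → V) : Monotone (rangeSize S) := fun a b h =>
  Finset.card_le_card fun x hx => by
    obtain ⟨k, hk, rfl⟩ := mem_trace.1 hx
    exact mem_trace.2 ⟨k, hk.trans h, rfl⟩

/-- Each summand indicates that the walk steps at time `k` onto the still unvisited neighbour in
direction `e`. Such steps reach pairwise distinct vertices. -/
theorem sum_trial_sub_success_le_rangeSize (e : ℤ × ℤ) (n : ℕ) (ξ : ℕ → ℤ × ℤ) :
    ∑ k ∈ Finset.range n, (trial (fun k => missed e k k) k ξ -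
      success (fun k => missed e k k) {ξ | ξ 0 = e}ᶜ k ξ) ≤ rangeSize (fun j => walk j ξ) n := by
  classical
  have h1 : ∀ k, trial (fun k => missed e k k) k ξ -
      success (fun k => missed e k k) {ξ | ξ 0 = e}ᶜ k ξ =
      if ξ ∈ missed e k k ∧ ξ k = e then 1 else 0 := fun k => by
    by_cases h2 : ξ ∈ missed e k k <;> by_cases h3 : ξ k = e <;>
      simp [trial, success, h2, h3, shift]
  simp only [h1]
  rw [Finset.sum_boole]
  refine Nat.cast_le.2 (Finset.card_le_card_of_injOn (fun k => walk (k + 1) ξ) ?_ ?_)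
  · intro k hk
    simp at hk
    exact mem_trace.2 ⟨k + 1, by omega, rfl⟩
  · have key : ∀ k k', k < k' → ξ ∈ missed e k' k' ∧ ξ k' = e →
        walk (k + 1) ξ ≠ walk (k' + 1) ξ := fun k k' h h' heq =>
      h'.1 (k + 1) h (by rw [heq, walk_succ, h'.2])
    intro k hk k' hk' heq
    simp only [Finset.coe_filter, Finset.mem_range, Set.mem_ofPred_eq] at hk hk'
    by_contra hne
    rcases lt_or_gt_of_ne hne with h | h
    · exact key k k' h hk'.2 heq
    · exact key k' k h hk.2 heq.symm

/-- With "the next step is not `e`" as success, of probability `3 / 4`, a positive fraction of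
trials fail, and each failure adds a new vertex to the range. -/
theorem ae_exists_sum_trial_le_rangeSize {e : ℤ × ℤ} (he : e ∈ unitSteps) :
    ∀ᵐ ξ ∂stepsLaw, ∃ K : ℝ, ∀ n, (1 - bernoulliCgf (3 / 4)) *
      ∑ k ∈ Finset.range n, trial (fun k => missed e k k) k ξ ≤
        rangeSize (fun j => walk j ξ) n + K := by
  have hdep : DependsOn (· ∈ {ξ : ℕ → ℤ × ℤ | ξ 0 = e}) (Finset.range 1 : Set ℕ) := by
    simpa using dependsOn_step_eq 0 e
  have hp : stepsLaw.real {ξ : ℕ → ℤ × ℤ | ξ 0 = e}ᶜ = 3 / 4 := by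
    rw [stepsLaw_real_compl (measurableSet_of_dependsOn hdep), stepsLaw_real_step_eq 0 he]
    norm_num
  filter_upwards [ae_exists_sum_success_le (dependsOn_missed_self e) one_pos
    (dependsOn_compl hdep)] with ξ ⟨K, hK⟩
  refine ⟨K, fun n => ?_⟩
  have h1 := hK n
  have h2 := sum_trial_sub_success_le_rangeSize e n ξ
  rw [Finset.sum_sub_distrib] at h2
  rw [hp] at h1
  linarith

/-- A neighbour missed up to `n` is missed up to `k` and during the next `T` steps, provided `k + T
≤ n`. The `T` late times and the extra index `n` account for `T + 1`. -/
theorem sum_missed_le_sum_success (e : ℤ × ℤ) (T n : ℕ) (ξ : ℕ → ℤ × ℤ) :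
    ∑ k ∈ Finset.range (n + 1), (missed e n k).indicator (1 : (ℕ → ℤ × ℤ) → ℝ) ξ ≤
      ∑ k ∈ Finset.range n, success (fun k => missed e k k) (avoid e T) k ξ + (T + 1) := by
  have hpt : ∀ k ∈ Finset.range (n + 1), (missed e n k).indicator (1 : (ℕ → ℤ × ℤ) → ℝ) ξ ≤
      success (fun k => missed e k k) (avoid e T) k ξ + if n < k + T then 1 else 0 := by
    intro k hk
    have hk' : k ≤ n := by simp at hk; omega
    have h0 := success_nonneg (D := fun k => missed e k k) (G := avoid e T) k ξ
    by_cases h1 : ξ ∈ missed e n k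
    · rw [Set.indicator_of_mem h1, Pi.one_apply]
      split_ifs with h2
      · linarith
      · have : success (fun k => missed e k k) (avoid e T) k ξ = 1 :=
          Set.indicator_of_mem (show ξ ∈ missed e k k ∩ shift k ⁻¹' avoid e T from
            ⟨fun j hj => h1 j (hj.trans hk'), shift_mem_avoid h1 (by omega)⟩) _
        rw [this, add_zero]
    · rw [Set.indicator_of_notMem h1]
      split_ifs <;> linarith
  refine (Finset.sum_le_sum hpt).trans ?_
  rw [Finset.sum_add_distrib, Finset.sum_range_succ]
  have h1 := sum_ite_lt_add_le n T
  have h2 := success_le_one (D := fun k => missed e k k) (G := avoid e T) n ξ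
  linarith

theorem ae_exists_boundarySize_le {T : ℕ} (hT : 2 ≤ T) :
    ∀ᵐ ξ ∂stepsLaw, ∃ K : ℝ, ∀ n, (boundarySize latticeGraph (fun j => walk j ξ) n : ℝ) ≤
      256 / (1 - bernoulliCgf (3 / 4)) / Real.log T * rangeSize (fun j => walk j ξ) n + K := by
  have h1 : ∀ᵐ ξ ∂stepsLaw, ∀ e ∈ unitSteps, ∃ K : ℝ, ∀ n, (1 - bernoulliCgf (3 / 4)) *
      ∑ k ∈ Finset.range n, trial (fun k => missed e k k) k ξ ≤
        rangeSize (fun j => walk j ξ) n + K :=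
    (ae_ball_iff unitSteps.countable_toSet).2 fun e he => ae_exists_sum_trial_le_rangeSize he
  have h2 : ∀ᵐ ξ ∂stepsLaw, ∀ e : ℤ × ℤ, ∃ K : ℝ, ∀ n,
      ∑ k ∈ Finset.range n, success (fun k => missed e k k) (avoid e T) k ξ ≤
        bernoulliCgf (stepsLaw.real (avoid e T)) *
          ∑ k ∈ Finset.range n, trial (fun k => missed e k k) k ξ + K :=
    ae_all_iff.2 fun e => ae_exists_sum_success_le (dependsOn_missed_self e) (by omega)
      (dependsOn_avoid e T)
  filter_upwards [h1, h2] with ξ h1 h2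
  have hδ : 0 < 1 - bernoulliCgf (3 / 4) :=
    sub_pos.2 (bernoulliCgf_lt_one (by norm_num) (by norm_num))
  set δ := 1 - bernoulliCgf (3 / 4)
  have hlog : 0 < Real.log T := Real.log_pos (by exact_mod_cast hT)
  have h3 : ∀ e ∈ unitSteps, ∃ K : ℝ, ∀ n, ∑ k ∈ Finset.range (n + 1),
      (missed e n k).indicator (1 : (ℕ → ℤ × ℤ) → ℝ) ξ ≤
        64 / δ / Real.log T * rangeSize (fun j => walk j ξ) n + K := by
    intro e he
    obtain ⟨K, hK⟩ := h1 e he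
    obtain ⟨K', hK'⟩ := h2 e
    refine ⟨64 / δ / Real.log T * K + K' + (T + 1), fun n => ?_⟩
    have h4 := sum_missed_le_sum_success e T n ξ
    have h5 := hK' n
    -- `64 = 2 * 32` combines `bernoulliCgf_le` with the avoidance bound; summing over four
    -- directions later gives 256.
    have h6 : bernoulliCgf (stepsLaw.real (avoid e T)) ≤ 64 / Real.log T := by
      refine (bernoulliCgf_le measureReal_nonneg).trans ?_
      have := avoid_le he hT le_rfl
      calc _ ≤ 2 * (32 / Real.log T) := by linarith
        _ = _ := by ring
    have h7 : 0 ≤ ∑ k ∈ Finset.range n, trial (fun k => missed e k k) k ξ :=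
      Finset.sum_nonneg fun k _ => trial_nonneg k ξ
    have h8 := mul_le_mul_of_nonneg_right h6 h7
    have h9 : 64 / Real.log T * ∑ k ∈ Finset.range n, trial (fun k => missed e k k) k ξ ≤
        64 / δ / Real.log T * (rangeSize (fun j => walk j ξ) n + K) := by
      calc _ = 64 / δ / Real.log T *
            (δ * ∑ k ∈ Finset.range n, trial (fun k => missed e k k) k ξ) := by field_simp
        _ ≤ _ := mul_le_mul_of_nonneg_left (hK n) (by positivity)
    linarith
  choose! K hK using h3
  refine ⟨∑ e ∈ unitSteps, K e, fun n => ?_⟩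
  refine (boundarySize_le n ξ).trans ((Finset.sum_le_sum fun e he => hK e he n).trans ?_)
  have hc : unitSteps.card = 4 := by decide
  rw [Finset.sum_add_distrib, Finset.sum_const, hc, nsmul_eq_mul]
  refine le_of_eq ?_
  push_cast
  ring

/-! ### Divergence of the range -/

/-- The event that the first `N` steps are all `(1, 0)`. -/
def straightRun (N : ℕ) : Set (ℕ → ℤ × ℤ) := {ξ | ∀ i < N, ξ i = (1, 0)}

theorem dependsOn_straightRun (N : ℕ) :
    DependsOn (· ∈ straightRun N) (Finset.range N : Set ℕ) := fun x y h => by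
  simp only [straightRun, Set.mem_ofPred_eq, eq_iff_iff]
  exact forall₂_congr fun i hi => by rw [h i (by simpa using hi)]

theorem stepsLaw_real_straightRun_pos (N : ℕ) : 0 < stepsLaw.real (straightRun N) := by
  induction N with
  | zero => simp [straightRun]
  | succ N ih =>
    have h : straightRun (N + 1) = straightRun N ∩ {ξ | ξ N = (1, 0)} := by
      ext ξ
      simp only [straightRun, Set.mem_ofPred_eq, Set.mem_inter_iff, Nat.forall_lt_succ_right]
    rw [h, stepsLaw_real_inter (S := Finset.range N) (T := {N}) (by simp)
      (dependsOn_straightRun N) (dependsOn_step_eq N _), stepsLaw_real_step_eq N (by decide)]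
    positivity

theorem lt_rangeSize_of_straightRun {N k : ℕ} {ξ : ℕ → ℤ × ℤ}
    (h : shift k ξ ∈ straightRun N) : N < rangeSize (fun j => walk j ξ) (k + N) := by
  have h1 : ∀ i ≤ N, (walk (k + i) ξ).1 = (walk k ξ).1 + i := by
    intro i
    induction i with
    | zero => simp
    | succ i ih =>
      intro hi
      have h2 : ξ (k + i) = (1, 0) := h i (by omega)
      rw [← add_assoc, walk_succ, Prod.fst_add, ih (by omega), h2]
      push_cast; ring
  have h2 : (Finset.range (N + 1)).card ≤ rangeSize (fun j => walk j ξ) (k + N) := by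
    refine Finset.card_le_card_of_injOn (fun i => walk (k + i) ξ) ?_ ?_
    · intro i hi
      simp at hi
      exact mem_trace.2 ⟨k + i, by omega, rfl⟩
    · intro i hi j hj hij
      simp at hi hj
      have := congrArg Prod.fst hij
      simp only [h1 i (by omega), h1 j (by omega)] at this
      omega
  simpa using h2

/-- If the range stayed below `N`, no straight run of length `N + 1` would ever occur. Every time
would then be a success for the complementary event, and `n ≤ c n + K` for all `n` contradicts `c <
1`. -/
theorem ae_tendsto_rangeSize :
    ∀ᵐ ξ ∂stepsLaw, Tendsto (fun n => (rangeSize (fun j => walk j ξ) n : ℝ)) atTop atTop := by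
  have h : ∀ᵐ ξ ∂stepsLaw, ∀ N : ℕ, ∃ K : ℝ, ∀ n,
      ∑ k ∈ Finset.range n, success (fun _ => Set.univ) (straightRun (N + 1))ᶜ k ξ ≤
        bernoulliCgf (stepsLaw.real (straightRun (N + 1))ᶜ) *
          ∑ k ∈ Finset.range n, trial (fun _ => Set.univ) k ξ + K :=
    ae_all_iff.2 fun N => ae_exists_sum_success_le (fun _ _ _ _ => rfl) N.succ_pos
      (dependsOn_compl (dependsOn_straightRun (N + 1)))
  filter_upwards [h] with ξ h
  refine tendsto_natCast_atTop_atTop.comp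
    (tendsto_atTop_atTop_of_monotone (rangeSize_mono _) fun N => ?_)
  obtain ⟨K, hK⟩ := h N
  have hc : bernoulliCgf (stepsLaw.real (straightRun (N + 1))ᶜ) < 1 := by
    refine bernoulliCgf_lt_one measureReal_nonneg ?_
    rw [stepsLaw_real_compl (measurableSet_of_dependsOn (dependsOn_straightRun (N + 1)))]
    linarith [stepsLaw_real_straightRun_pos (N + 1)]
  by_contra! hcon
  have h1 : ∀ k, success (fun _ => Set.univ) (straightRun (N + 1))ᶜ k ξ = 1 := fun k => by
    refine Set.indicator_of_mem (show ξ ∈ Set.univ ∩ shift k ⁻¹' (straightRun (N + 1))ᶜ from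
      ⟨trivial, fun hmem => ?_⟩) _
    have := lt_rangeSize_of_straightRun hmem
    have := hcon (k + (N + 1))
    omega
  simp only [h1, trial, Set.indicator_univ, Pi.one_apply, Finset.sum_const, Finset.card_range,
    nsmul_eq_mul, mul_one] at hK
  obtain ⟨n, hn⟩ := exists_nat_gt (K / (1 - bernoulliCgf (stepsLaw.real (straightRun (N + 1))ᶜ)))
  rw [div_lt_iff₀ (by linarith)] at hn
  have := hK n
  linarith

/-! ### Conclusion and transfer to the law on paths -/

theorem ae_tendsto_boundarySize_div_rangeSize :
    ∀ᵐ ξ ∂stepsLaw, Tendsto (fun n => (boundarySize latticeGraph (fun j => walk j ξ) n : ℝ) /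
      rangeSize (fun j => walk j ξ) n) atTop (𝓝 0) := by
  have h : ∀ᵐ ξ ∂stepsLaw, ∀ T : ℕ, 2 ≤ T → ∃ K : ℝ, ∀ n,
      (boundarySize latticeGraph (fun j => walk j ξ) n : ℝ) ≤
      256 / (1 - bernoulliCgf (3 / 4)) / Real.log T * rangeSize (fun j => walk j ξ) n + K :=
    ae_all_iff.2 fun T => by
      by_cases hT : 2 ≤ T
      · simpa only [hT, forall_const] using ae_exists_boundarySize_le hT
      · simp [hT]
  filter_upwards [h, ae_tendsto_rangeSize] with ξ h hR
  refine Metric.tendsto_atTop.2 fun ε hε => ?_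
  have hlim : Tendsto (fun T : ℕ => 256 / (1 - bernoulliCgf (3 / 4)) / Real.log T) atTop (𝓝 0) :=
    (Real.tendsto_log_atTop.comp tendsto_natCast_atTop_atTop).const_div_atTop _
  -- `T` makes the coefficient of `R_n` less than `ε / 2`; only then is the random constant `K`
  -- fixed and absorbed by taking `R_n > 2 K / ε`.
  obtain ⟨T, hT, hT2⟩ := ((hlim.eventually (gt_mem_nhds (half_pos hε))).and
    (eventually_ge_atTop 2)).exists
  obtain ⟨K, hK⟩ := h T hT2
  obtain ⟨n₀, hn₀⟩ := eventually_atTop.1 (hR.eventually_gt_atTop (max 0 (2 * K / ε)))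
  refine ⟨n₀, fun n hn => ?_⟩
  have h1 := hn₀ n hn
  have hRpos : (0 : ℝ) < rangeSize (fun j => walk j ξ) n := (le_max_left _ _).trans_lt h1
  have h2 : 2 * K < rangeSize (fun j => walk j ξ) n * ε :=
    (div_lt_iff₀ hε).1 ((le_max_right _ _).trans_lt h1)
  rw [Real.dist_eq, sub_zero, abs_of_nonneg (by positivity), div_lt_iff₀ hRpos]
  have h3 := mul_lt_mul_of_pos_right hT hRpos
  have h4 := hK n
  linarith

theorem trace_congr {V : Type*} {S S' : ℕ → V} {n : ℕ}
    (h : ∀ i ∈ (Finset.range (n + 1) : Set ℕ), S i = S' i) : trace S n = trace S' n := by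
  classical
  simp only [trace]
  convert! Finset.image_congr h

theorem measurable_boundarySize (G : SimpleGraph (ℤ × ℤ)) (n : ℕ) :
    Measurable fun S : ℕ → ℤ × ℤ => (boundarySize G S n : ℝ) :=
  measurable_of_dependsOn (S := Finset.range (n + 1)) fun S S' h => by
    have : innerBoundary G S n = innerBoundary G S' n := by
      ext x
      simp only [innerBoundary, Finset.mem_filter, trace_congr h]
    simp only [boundarySize, this]

theorem measurable_rangeSize (n : ℕ) :
    Measurable fun S : ℕ → ℤ × ℤ => (rangeSize S n : ℝ) :=
  measurable_of_dependsOn (S := Finset.range (n + 1)) fun S S' h => by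
    simp only [rangeSize, trace_congr h]

end TraceBoundary

end

theorem lemma3p3 :
    (limsup (fun n : ℕ =>
        ENNReal.ofReal (Real.log n ^ 4 / (n : ℝ) ^ 2) *
          ∫⁻ S, (TraceBoundary.boundarySize TraceBoundary.latticeGraph S n : ℝ≥0∞) ^ 2
            ∂(TraceBoundary.srwLaw 0)) atTop < ∞) ∧
    (∀ᵐ S ∂(TraceBoundary.srwLaw 0),
      Tendsto (fun n : ℕ =>
        (TraceBoundary.boundarySize TraceBoundary.latticeGraph S n : ℝ) /
          (TraceBoundary.rangeSize S n : ℝ)) atTop (𝓝 0)) := by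
  refine ⟨TraceBoundary.limsup_boundarySize_sq_lt_top, ?_⟩
  -- Measurability of the convergence event is needed to pull the almost sure statement back along
  -- `pathOfSteps`.
  have hm : MeasurableSet {S : ℕ → ℤ × ℤ | Tendsto (fun n : ℕ =>
      (TraceBoundary.boundarySize TraceBoundary.latticeGraph S n : ℝ) /
        (TraceBoundary.rangeSize S n : ℝ)) atTop (𝓝 0)} :=
    measurableSet_tendsto (𝓝 0) fun n => (TraceBoundary.measurable_boundarySize _ n).div
      (TraceBoundary.measurable_rangeSize n)
  rw [TraceBoundary.srwLaw,
    ae_map_iff (TraceBoundary.measurable_pathOfSteps 0).aemeasurable hm]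
  simp only [TraceBoundary.pathOfSteps_zero]
  exact TraceBoundary.ae_tendsto_boundarySize_div_rangeSize
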